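/- Let $n\ge 0$, $d\ge 1$ and $e\ge 1$ be integers, let $H_1,\dots,H_d$ be pairwise distinct linear hyperplanes in $\mathbf{C}^{n+1}$ (a central arrangement of $d$ hyperplanes), and let $A=H_1\cup\dots\cup H_d$. Let $p:\widetilde{(\mathbf{C}^{n+1}-A)}_e\to \mathbf{C}^{n+1}-A$ be the $e$-fold cyclic cover, i.e. the connected covering space corresponding to the kernel of the homomorphism $\pi_1(\mathbf{C}^{n+1}-A)\to H_1(\mathbf{C}^{n+1}-A,\mathbf{Z})=\mathbf{Z}^d\to\mathbf{Z}/e\mathbf{Z}$ that sends the positively oriented meridian of each hyperplane $H_j$ to $1$; equivalently, a loop is sent to the sum modulo $e$ of its linking numbers with $H_1,\dots,H_d$, the linking number with $H_j$ being the winding number around $0$ of a linear form defining $H_j$ along the loop. Let $T$ be any deck transformation of $p$ and let $i\ge 0$. Then every eigenvalue $\xi\in\mathbf{C}$ of the endomorphism induced by $T$ on the singular homology $H_i\bigl(\widetilde{(\mathbf{C}^{n+1}-A)}_e;\mathbf{C}\bigr)$ is a root of unity whose order divides both $e$ and $d$. -/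

import Mathlib

/-- A central arrangement of `d` hyperplanes in `ℂⁿ⁺¹`: pairwise distinct linear hyperplanes
`Hᵢ = {x | form i x = 0}`, given by nonzero linear forms.  Equivalently, the cone over an
arrangement of `d` distinct hyperplanes in `ℙⁿ`. -/
structure CentralArrangement (n d : ℕ) where
  /-- the defining linear forms -/
  form : Fin d → Module.Dual ℂ (Fin (n + 1) → ℂ)
  form_ne_zero : ∀ i, form i ≠ 0
  ker_injective : Function.Injective fun i => LinearMap.ker (form i)

/-- The punctured complex plane `ℂ* = ℂ ∖ {0}`. -/
abbrev PuncturedPlane : Type := {z : ℂ // z ≠ 0}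

/-- The isomorphism `k ↦ 2πik` from `ℤ` to the period lattice `2πiℤ` of the exponential. -/
noncomputable def periodEquiv : ℤ ≃+ AddSubgroup.zmultiples (2 * Real.pi * Complex.I) :=
  AddEquiv.ofBijective
    (((zmultiplesHom ℂ) (2 * Real.pi * Complex.I)).codRestrict
      (AddSubgroup.zmultiples (2 * Real.pi * Complex.I)) fun k => ⟨k, rfl⟩)
    ⟨fun a b h => by
      have h' : a • (2 * Real.pi * Complex.I : ℂ) = b • (2 * Real.pi * Complex.I : ℂ) :=
        congrArg Subtype.val h
      simpa [zsmul_eq_mul] using h',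
    fun ⟨_, k, hk⟩ => ⟨k, Subtype.ext hk⟩⟩

/-- The winding number around `0`, as a homomorphism `π₁(ℂ*, z) → ℤ`: the class of a loop `γ`
is sent to the integer `k` such that a lift `γ'` of `γ` along the covering `exp : ℂ → ℂ*`
satisfies `γ' 1 = 2πik + γ' 0`. -/
noncomputable def windingHom (z : PuncturedPlane) :
    FundamentalGroup PuncturedPlane z →* Multiplicative ℤ :=
  (AddMonoidHom.toMultiplicative periodEquiv.symm.toAddMonoidHom).comp <|
    MulOpposite.opMulEquiv.symm.toMonoidHom.comp <|
      Complex.isAddQuotientCoveringMap_exp.fundamentalGroupToMulOpposite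
        ⟨Complex.log z, Subtype.ext (Complex.exp_log z.2)⟩

/-- The winding number in terms of logarithms: if `g` is a continuous logarithm of the loop `γ`
and `g 1 = 2πik + g 0`, then `γ` has winding number `k`. -/
theorem windingHom_eq {z : PuncturedPlane} (γ : Path z z) (g : C(unitInterval, ℂ)) (k : ℤ)
    (hg : ∀ t, Complex.exp (g t) = (γ t).1) (hk : g 1 = 2 * Real.pi * Complex.I * k + g 0) :
    windingHom z (FundamentalGroup.fromPath (.mk γ)) = Multiplicative.ofAdd k := by
  have hz : Complex.exp (g 0) = z.1 := by rw [hg]; simp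
  have cov := Complex.isAddQuotientCoveringMap_exp.isCoveringMap
  have hlog : Complex.exp (Complex.log z.1) = z.1 := Complex.exp_log z.2
  let G : C(unitInterval, ℂ) := ⟨fun t => g t + (Complex.log z - g 0), by fun_prop⟩
  have h0 : γ.toContinuousMap 0 =
      (⟨Complex.exp (Complex.log z.1), Complex.exp_ne_zero _⟩ : PuncturedPlane) :=
    Subtype.ext (by simp [hlog])
  have hG : G = Complex.isAddQuotientCoveringMap_exp.isCoveringMap.liftPath γ.toContinuousMap
      (Complex.log z.1) h0 := by
    rw [IsCoveringMap.eq_liftPath_iff']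
    refine ⟨funext fun t => Subtype.ext ?_, by simp [G]⟩
    change Complex.exp (g t + (Complex.log z - g 0)) = (γ t).1
    rw [Complex.exp_add, Complex.exp_sub, hlog, hz, div_self z.2, mul_one, hg]
  have key : Complex.isAddQuotientCoveringMap_exp.fundamentalGroupToMulOpposite
        ⟨Complex.log z, Subtype.ext (Complex.exp_log z.2)⟩ (FundamentalGroup.fromPath (.mk γ)) =
      MulOpposite.op (Multiplicative.ofAdd (periodEquiv k)) := by
    rw [IsAddQuotientCoveringMap.fundamentalGroupToMulOpposite_apply_eq_Iff]
    change (k • (2 * Real.pi * Complex.I : ℂ)) + Complex.log z = 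
       Complex.isAddQuotientCoveringMap_exp.isCoveringMap.liftPath γ.toContinuousMap
      (Complex.log z.1) h0 1
    rw [← hG]
    simp only [G, ContinuousMap.coe_mk, hk, zsmul_eq_mul]
    ring
  change Multiplicative.ofAdd (periodEquiv.symm (Multiplicative.toAdd (MulOpposite.unop
    (Complex.isAddQuotientCoveringMap_exp.fundamentalGroupToMulOpposite
        ⟨Complex.log z, Subtype.ext (Complex.exp_log z.2)⟩ (FundamentalGroup.fromPath (.mk γ)))))) = _
  rw [key]
  simp

namespace CentralArrangement

variable {n d : ℕ} (A : CentralArrangement n d)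

/-- The complement `ℂⁿ⁺¹ ∖ ⋃ᵢ Hᵢ` of the arrangement. -/
def complement : Set (Fin (n + 1) → ℂ) := {x | ∀ i, A.form i x ≠ 0}

/-- The `i`-th linear form as a continuous map from the complement to `ℂ*`. -/
noncomputable def formMap (i : Fin d) : C(A.complement, PuncturedPlane) where
  toFun x := ⟨A.form i x, x.2 i⟩
  continuous_toFun := ((A.form i).continuous_of_finiteDimensional.comp
    continuous_subtype_val).subtype_mk _

/-- The linking number of a loop with the hyperplane `Hᵢ`, i.e. the winding number of the
`i`-th linear form along the loop.  For varying `i` these are the coordinates of the abelianization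
`π₁ → H₁ = ℤᵈ` with respect to the basis of positively oriented meridians of the hyperplanes. -/
noncomputable def linkingHom (i : Fin d) (x : A.complement) :
    FundamentalGroup A.complement x →* Multiplicative ℤ :=
  (windingHom (A.formMap i x)).comp (FundamentalGroup.map (A.formMap i) x)

/-- The homomorphism `π₁ → H₁ = ℤᵈ → ℤ`, the second map of which sends the meridian of every
hyperplane to `1`: the sum of the linking numbers with all the hyperplanes. -/
noncomputable def totalLinkingHom (x : A.complement) :
    FundamentalGroup A.complement x →* Multiplicative ℤ :=
  ∏ i, A.linkingHom i x

/-- The total linking number sends the positively oriented meridian of each hyperplane to `1`: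
if the line `a + ℂv` crosses `Hᵢ` at `a`, and the disc of radius `1` about `a` in it meets no other
hyperplane, then the boundary circle `t ↦ a + exp (2πit) v` of this disc is sent to `1`. -/
theorem totalLinkingHom_meridian (i : Fin d) (a v : Fin (n + 1) → ℂ) (hi : A.form i a = 0) (hv : A.form i v ≠ 0)
    (hj : ∀ j, j ≠ i → ∀ w : ℂ, ‖w‖ ≤ 1 → A.form j (a + w • v) ≠ 0)
    (x : A.complement) (γ : Path x x)
    (hγ : ∀ t : unitInterval, (γ t).1 = a + Complex.exp (2 * Real.pi * Complex.I * (t : ℝ)) • v) :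
    A.totalLinkingHom x (FundamentalGroup.fromPath (.mk γ)) = Multiplicative.ofAdd 1 := by
  have hn : ∀ t : unitInterval, ‖Complex.exp (2 * Real.pi * Complex.I * (t : ℝ))‖ = 1 := fun t => by
    rw [show (2 * Real.pi * Complex.I * (t : ℝ) : ℂ) = ((2 * Real.pi * t : ℝ) : ℂ) * Complex.I by
      push_cast; ring, Complex.norm_exp_ofReal_mul_I]
  have hl : ∀ j, A.linkingHom j x (FundamentalGroup.fromPath (.mk γ)) =
      Multiplicative.ofAdd (if j = i then 1 else 0) := by
    intro j
    change windingHom (A.formMap j x) (FundamentalGroup.fromPath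
      (.mk (γ.map (A.formMap j).continuous))) = _
    split_ifs with h
    · subst h
      refine windingHom_eq _ ⟨fun t => 2 * Real.pi * Complex.I * (t : ℝ) +
        Complex.log (A.form j v), by fun_prop⟩ 1 (fun t => ?_) (by simp)
      change _ = A.form j (γ t).1
      rw [hγ]
      simp [Complex.exp_add, Complex.exp_log hv, hi]
    · have ha : A.form j a ≠ 0 := by simpa using hj j h 0 (by simp)
      have hlt : ‖A.form j v / A.form j a‖ < 1 := by
        by_contra hc
        have hv' : A.form j v ≠ 0 := by rintro h0; simp [h0] at hc
        refine hj j h (-(A.form j a / A.form j v)) ?_ (by simp; field_simp; simp)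
        rw [norm_neg, ← inv_div, norm_inv]
        exact inv_le_one_of_one_le₀ (not_lt.1 hc)
      have hs : ∀ t : unitInterval, 1 + Complex.exp (2 * Real.pi * Complex.I * (t : ℝ)) *
          (A.form j v / A.form j a) ∈ Complex.slitPlane := fun t =>
        Complex.mem_slitPlane_of_norm_lt_one (by rw [norm_mul, hn, one_mul]; exact hlt)
      refine windingHom_eq _ ⟨fun t => Complex.log (A.form j a) + Complex.log (1 +
        Complex.exp (2 * Real.pi * Complex.I * (t : ℝ)) * (A.form j v / A.form j a)), ?_⟩ 0
        (fun t => ?_) ?_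
      · exact continuous_const.add (Continuous.clog (by fun_prop) hs)
      · change _ = A.form j (γ t).1
        rw [hγ]
        simp only [ContinuousMap.coe_mk]
        rw [Complex.exp_add, Complex.exp_log ha, Complex.exp_log (Complex.slitPlane_ne_zero (hs t))]
        simp
        field_simp
      · simp
  unfold totalLinkingHom
  rw [MonoidHom.finsetProd_apply]
  simp_rw [hl]
  rw [← ofAdd_sum]
  simp

/-- The reduction modulo `e` of the total linking number, a homomorphism
`π₁ → H₁ = ℤᵈ → ℤ/eℤ` that sends the meridian of every hyperplane to `1`. -/
noncomputable def totalLinkingModHom (e : ℕ) (x : A.complement) :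
    FundamentalGroup A.complement x →* Multiplicative (ZMod e) :=
  (AddMonoidHom.toMultiplicative (Int.castAddHom (ZMod e))).comp (A.totalLinkingHom x)

/-- `p : E → ℂⁿ⁺¹ ∖ ⋃ᵢ Hᵢ` is the `e`-fold cyclic cover of the complement: the connected
covering space that corresponds to the homomorphism `π₁ → H₁ → ℤ/eℤ` sending the meridian of
every hyperplane to `1`, i.e. the image of `π₁(E)` is the kernel of this homomorphism. -/
structure IsCyclicCover (e : ℕ) {E : Type} [TopologicalSpace E] (p : C(E, A.complement)) :
    Prop where
  isCoveringMap : IsCoveringMap p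
  pathConnectedSpace : PathConnectedSpace E
  range_map_eq_ker : ∀ y : E,
    (FundamentalGroup.map p y).range = (A.totalLinkingModHom e (p y)).ker

end CentralArrangement

/-- The endomorphism induced by a continuous self-map on the singular homology
`Hᵢ(E; ℂ)` with complex coefficients. -/
noncomputable def homologyEnd {E : Type} [TopologicalSpace E] (i : ℕ) (T : C(E, E)) :
    Module.End ℂ (((AlgebraicTopology.singularHomologyFunctor (ModuleCat.{0} ℂ) i).obj
      (ModuleCat.of ℂ ℂ)).obj (TopCat.of E)) :=
  (((AlgebraicTopology.singularHomologyFunctor (ModuleCat.{0} ℂ) i).obj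
    (ModuleCat.of ℂ ℂ)).map (TopCat.ofHom T)).hom

/-!
A deck transformation `T` of the `e`-fold cyclic cover `p : E → X` of the complement `X` satisfies
two relations, one strict and one up to homotopy.

Covering maps from a connected space which agree at one point agree, so an identity between
powers of deck transformations may be tested at a single `y : E`.  If `T y` is the endpoint of the
lift at `y` of a loop `g` at `p y`, then `T^m y` is the endpoint of the lift of `g ^ m`
(`IsCoveringMap.iterate_eq_monodromy_pow`), and two loops with the same value under
`π₁(X) → ℤ/e` have lifts with the same endpoint (`IsCoveringMap.monodromy_eq_of_ker_le_range`).
Hence powers of deck transformations are equal as soon as the corresponding values in `ℤ/e` are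
(`IsCoveringMap.iterate_eq_iterate`).

* `T^e = id`, because `e` annihilates `ℤ/e`.
* The complement of a central arrangement is stable under multiplication by `ℂ*`.  The homotopy
  `(t, x) ↦ exp (2πit) x` from the identity to itself lifts to a homotopy from the identity of `E` to
  a deck transformation `S`.  The loop `t ↦ exp (2πit) x` winds once around each of the `d`
  hyperplanes, so `S` corresponds to `d`.  If `T` corresponds to `k`, then `T^d` and `S^k` both
  correspond to `k * d`; therefore `T^d = S^k`, which is homotopic to the identity.

By homotopy invariance of singular homology both `T^e` and `T^d` act as the identity on homology,
so `ξ ^ e = ξ ^ d = 1`.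
-/

/-! ### Deck transformations and monodromy -/

namespace IsCoveringMap

variable {E X : Type*} [TopologicalSpace E] [TopologicalSpace X] {p : C(E, X)}

/-- Monodromy commutes with every continuous self-map of the total space over the base. -/
theorem monodromy_apply_of_comp_eq (cov : IsCoveringMap p) (f : C(E, E)) (hf : ∀ y, p (f y) = p y)
    {x : X} (γ : Path.Homotopic.Quotient x x) (y : p ⁻¹' {x}) :
    cov.monodromy γ ⟨f y, (hf y).trans y.2⟩ =
      ⟨f (cov.monodromy γ y), (hf _).trans (cov.monodromy γ y).2⟩ := by
  obtain ⟨γ⟩ := γ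
  refine Subtype.ext ?_
  have h0 : γ 0 = p y := γ.source.trans y.2.symm
  have key : f.comp (cov.liftPath γ y h0) = cov.liftPath γ (f y) (h0.trans (hf y).symm) := by
    rw [cov.eq_liftPath_iff']
    refine ⟨?_, by simp [cov.liftPath_zero]⟩
    ext t
    simpa [hf] using congr_fun (cov.liftPath_lifts γ y h0) t
  exact congr($key 1).symm

/-- If `f y` is the endpoint of the lift of the loop `g` at `y`, then `f^[m] y` is the endpoint of
the lift of `g ^ m`. -/
theorem iterate_eq_monodromy_pow (cov : IsCoveringMap p) (f : C(E, E)) (hf : ∀ y, p (f y) = p y)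
    {x : X} (y : p ⁻¹' {x}) (g : FundamentalGroup X x) (hg : f y = cov.monodromyPerm x g y)
    (m : ℕ) : f^[m] y = cov.monodromyPerm x (g ^ m) y := by
  induction m with
  | zero => rw [pow_zero, map_one]; rfl
  | succ m ih =>
    rw [Function.iterate_succ_apply', ih, pow_succ, map_mul, Equiv.Perm.mul_apply]
    have hy : cov.monodromyPerm x g y = ⟨f y, (hf y).trans y.2⟩ := Subtype.ext hg.symm
    rw [hy]
    exact congr($(cov.monodromy_apply_of_comp_eq f hf (g ^ m) y).1).symm

/-- In a path-connected covering space, a self-map over the base moves `y` along the lift of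
some loop. -/
theorem exists_apply_eq_monodromy [PathConnectedSpace E] (cov : IsCoveringMap p) (f : C(E, E))
    (hf : ∀ y, p (f y) = p y) (y : E) :
    ∃ g : FundamentalGroup X (p y), f y = cov.monodromyPerm (p y) g ⟨y, rfl⟩ := by
  let Γ : Path.Homotopic.Quotient y (f y) := .mk (PathConnectedSpace.somePath y (f y))
  refine ⟨(Γ.map p).cast rfl (hf y).symm, ?_⟩
  exact congr($(cov.monodromy_eq_of_map_eq (ex := ⟨y, rfl⟩) (ey := ⟨f y, hf y⟩)
    (γ := (Γ.map p).cast rfl (hf y).symm) Γ (by simp; rfl)).1).symm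

/-- If the image of the fundamental group of the covering space contains the kernel of `φ`, then
the endpoint of the lift of a loop depends only on the value of `φ` on the loop. -/
theorem monodromy_eq_of_ker_le_range (cov : IsCoveringMap p) {y : E} {B : Type*} [Group B]
    (φ : FundamentalGroup X (p y) →* B) (hφ : φ.ker ≤ (FundamentalGroup.map p y).range)
    {g h : FundamentalGroup X (p y)} (hgh : φ g = φ h) :
    cov.monodromyPerm (p y) g ⟨y, rfl⟩ = cov.monodromyPerm (p y) h ⟨y, rfl⟩ := by
  obtain ⟨c, hc⟩ := hφ (show h⁻¹ * g ∈ φ.ker by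
    rw [MonoidHom.mem_ker, map_mul, map_inv, hgh, inv_mul_cancel])
  have h1 : cov.monodromyPerm (p y) (h⁻¹ * g) ⟨y, rfl⟩ = ⟨y, rfl⟩ := by
    rw [← hc]
    exact cov.monodromy_map c
  rwa [map_mul, map_inv, Equiv.Perm.mul_apply, Equiv.Perm.inv_eq_iff_eq] at h1

/-- Iterates of two self-maps over the base are equal if the corresponding powers of the values of
`φ` are. -/
theorem iterate_eq_iterate [PathConnectedSpace E] (cov : IsCoveringMap p) {y : E} {B : Type*}
    [Group B] (φ : FundamentalGroup X (p y) →* B)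
    (hφ : φ.ker ≤ (FundamentalGroup.map p y).range) (f f' : C(E, E)) (hf : ∀ y, p (f y) = p y)
    (hf' : ∀ y, p (f' y) = p y) {g g' : FundamentalGroup X (p y)}
    (hg : f y = cov.monodromyPerm (p y) g ⟨y, rfl⟩)
    (hg' : f' y = cov.monodromyPerm (p y) g' ⟨y, rfl⟩) {m m' : ℕ}
    (h : φ g ^ m = φ g' ^ m') : f^[m] = f'^[m'] := by
  have hp : ∀ (k : C(E, E)), (∀ y, p (k y) = p y) → ∀ n, p ∘ k^[n] = p := fun k hk n => by
    induction n with
    | zero => rfl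
    | succ n ih => rw [Function.iterate_succ, ← Function.comp_assoc, ih]; exact funext hk
  refine cov.eq_of_comp_eq (f.continuous.iterate m) (f'.continuous.iterate m')
    ((hp f hf m).trans (hp f' hf' m').symm) y ?_
  refine (cov.iterate_eq_monodromy_pow f hf ⟨y, rfl⟩ g hg m).trans (Eq.trans ?_
    (cov.iterate_eq_monodromy_pow f' hf' ⟨y, rfl⟩ g' hg' m').symm)
  exact congrArg Subtype.val (cov.monodromy_eq_of_ker_le_range φ hφ (g := g ^ m) (h := g' ^ m')
    (by rw [map_pow, map_pow, h]))

end IsCoveringMap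

/-! ### The action on homology -/

section Homology

open CategoryTheory

variable {E : Type} [TopologicalSpace E] (i : ℕ)

theorem homologyEnd_eq_of_homotopic {f g : C(E, E)} (h : f.Homotopic g) :
    homologyEnd i f = homologyEnd i g := by
  obtain ⟨H⟩ := h
  exact congrArg ModuleCat.Hom.hom (TopCat.Homotopy.congr_homologyMap_singularChainComplexFunctor
    (f := TopCat.ofHom f) (g := TopCat.ofHom g) H (ModuleCat.of ℂ ℂ) i)

theorem homologyEnd_id : homologyEnd i (ContinuousMap.id E) = 1 := by
  unfold homologyEnd
  rw [TopCat.ofHom_id, CategoryTheory.Functor.map_id]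
  rfl

theorem homologyEnd_comp (f g : C(E, E)) :
    homologyEnd i (f.comp g) = homologyEnd i f * homologyEnd i g := by
  unfold homologyEnd
  rw [TopCat.ofHom_comp, CategoryTheory.Functor.map_comp]
  rfl

theorem homologyEnd_iterate (f : C(E, E)) (m : ℕ) :
    homologyEnd i ⟨f^[m], f.continuous.iterate m⟩ = homologyEnd i f ^ m := by
  induction m with
  | zero => exact homologyEnd_id i
  | succ m ih =>
    rw [pow_succ, ← ih, ← homologyEnd_comp]
    rfl

theorem orderOf_dvd_of_hasEigenvalue_of_pow_eq_one {K V : Type*} [Field K] [AddCommGroup V]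
    [Module K V] {L : Module.End K V} {ξ : K} (hξ : L.HasEigenvalue ξ) {m : ℕ} (hL : L ^ m = 1) :
    orderOf ξ ∣ m := by
  obtain ⟨v, hv⟩ := hξ.exists_hasEigenvector
  refine orderOf_dvd_of_pow_eq_one ?_
  have h := hv.pow_apply m
  rw [hL, Module.End.one_apply] at h
  exact smul_left_injective K hv.2 (by simpa using h.symm)

end Homology

/-! ### The rotation of the complement -/

namespace CentralArrangement

variable {n d : ℕ} (A : CentralArrangement n d)

/-- The homotopy `(t, x) ↦ exp (2πit) x` from the identity of the complement to itself. -/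
noncomputable def rotation : C(unitInterval × A.complement, A.complement) where
  toFun q := ⟨Complex.exp (2 * Real.pi * Complex.I * (q.1 : ℝ)) • q.2.1, fun i => by
    simpa using q.2.2 i⟩
  continuous_toFun := by fun_prop

theorem rotation_zero (x : A.complement) : A.rotation (0, x) = x := Subtype.ext (by simp [rotation])

theorem rotation_one (x : A.complement) : A.rotation (1, x) = x := Subtype.ext (by simp [rotation])

/-- The orbit of `x` under the circle, as a loop in the complement. -/
noncomputable def rotationLoop (x : A.complement) : Path x x where
  toFun t := A.rotation (t, x)
  source' := A.rotation_zero x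
  target' := A.rotation_one x

/-- Each linear form has winding number one along an orbit of the circle. -/
theorem linkingHom_rotationLoop (i : Fin d) (x : A.complement) :
    A.linkingHom i x (FundamentalGroup.fromPath (.mk (A.rotationLoop x))) =
      Multiplicative.ofAdd 1 := by
  change windingHom (A.formMap i x) (FundamentalGroup.fromPath
    (.mk ((A.rotationLoop x).map (A.formMap i).continuous))) = _
  refine windingHom_eq _ ⟨fun t => 2 * Real.pi * Complex.I * (t : ℝ) +
    Complex.log (A.form i x), by fun_prop⟩ 1 (fun t => ?_) (by simp)
  change _ = A.form i (Complex.exp (2 * Real.pi * Complex.I * (t : ℝ)) • x.1)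
  simp [Complex.exp_add, Complex.exp_log (x.2 i)]

theorem totalLinkingModHom_rotationLoop (e : ℕ) (x : A.complement) :
    A.totalLinkingModHom e x (FundamentalGroup.fromPath (.mk (A.rotationLoop x))) =
      Multiplicative.ofAdd (d : ZMod e) := by
  have h : A.totalLinkingHom x (FundamentalGroup.fromPath (.mk (A.rotationLoop x))) =
      Multiplicative.ofAdd (d : ℤ) := by
    unfold totalLinkingHom
    rw [MonoidHom.finsetProd_apply]
    simp_rw [linkingHom_rotationLoop]
    rw [← ofAdd_sum]
    simp
  change Multiplicative.ofAdd (((A.totalLinkingHom x _).toAdd : ℤ) : ZMod e) = _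
  rw [h]
  simp

/-- The rotation of the complement lifts to a homotopy from the identity of a covering space to
a deck transformation, whose monodromy is that of the orbits of the circle. -/
theorem exists_lift_rotation {E : Type} [TopologicalSpace E] {p : C(E, A.complement)}
    (cov : IsCoveringMap p) :
    ∃ S : C(E, E), S.Homotopic (ContinuousMap.id E) ∧ (∀ y, p (S y) = p y) ∧
      ∀ y, S y = cov.monodromyPerm (p y)
        (FundamentalGroup.fromPath (.mk (A.rotationLoop (p y)))) ⟨y, rfl⟩ := by
  let H : C(unitInterval × E, A.complement) :=
    A.rotation.comp (.prodMap (.id _) p)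
  have H0 : ∀ y, H (0, y) = p (ContinuousMap.id E y) := fun y => A.rotation_zero (p y)
  let F := cov.liftHomotopy H (.id E) H0
  refine ⟨F.comp (.prodMk (.const E 1) (.id E)), ?_, fun y => ?_, fun y => rfl⟩
  · exact ContinuousMap.Homotopic.symm
      ⟨⟨F, fun y => cov.liftHomotopy_zero H (.id E) H0 y, fun y => rfl⟩⟩
  · exact (congr_fun (cov.liftHomotopy_lifts H (.id E) H0) (1, y)).trans (A.rotation_one (p y))

end CentralArrangement

/-- Every eigenvalue of a deck transformation `T` of the `e`-fold cyclic cover `E` of the complement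
of a central arrangement of `d` hyperplanes in `ℂⁿ⁺¹`, acting on `Hᵢ(E; ℂ)`, has finite order
dividing both `e` and `d`. -/
theorem proposition2p1 {n d : ℕ} (A : CentralArrangement n d) (e : ℕ) (he : 0 < e)
    {E : Type} [TopologicalSpace E] (p : C(E, A.complement)) (hp : A.IsCyclicCover e p)
    (T : E ≃ₜ E) (hT : ∀ y, p (T y) = p y) (i : ℕ) (ξ : ℂ)
    (hξ : Module.End.HasEigenvalue (homologyEnd i (T : C(E, E))) ξ) :
    orderOf ξ ∣ e ∧ orderOf ξ ∣ d := by
  have := hp.pathConnectedSpace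
  have : NeZero e := ⟨he.ne'⟩
  have cov := hp.isCoveringMap
  obtain ⟨y⟩ : Nonempty E := inferInstance
  have hker := (hp.range_map_eq_ker y).ge
  obtain ⟨g, hg⟩ := cov.exists_apply_eq_monodromy (T : C(E, E)) hT y
  constructor <;> refine orderOf_dvd_of_hasEigenvalue_of_pow_eq_one hξ ?_
  · have hT_pow : (T : C(E, E))^[e] = (T : C(E, E))^[0] := by
      refine cov.iterate_eq_iterate _ hker _ _ hT hT hg hg ?_
      rw [pow_zero, ← ofAdd_toAdd (A.totalLinkingModHom e (p y) g), ← ofAdd_nsmul]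
      simp
    rw [← homologyEnd_iterate, ← homologyEnd_id]
    exact congrArg (homologyEnd i) (DFunLike.coe_injective hT_pow)
  · obtain ⟨S, hS, hSp, hSy⟩ := A.exists_lift_rotation cov
    -- A natural number representing the class of `T` in `ℤ/e`.
    let k : ℕ := (A.totalLinkingModHom e (p y) g).toAdd.val
    have hTS : (T : C(E, E))^[d] = S^[k] := by
      refine cov.iterate_eq_iterate _ hker _ _ hT hSp hg (hSy y) ?_
      rw [A.totalLinkingModHom_rotationLoop, ← ofAdd_toAdd (A.totalLinkingModHom e (p y) g),
        ← ofAdd_nsmul, ← ofAdd_nsmul]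
      simp [k, mul_comm]
    rw [← homologyEnd_iterate]
    refine (congrArg (homologyEnd i) (DFunLike.coe_injective (a₂ := ⟨S^[k],
      S.continuous.iterate k⟩) hTS)).trans ?_
    rw [homologyEnd_iterate, homologyEnd_eq_of_homotopic i hS, homologyEnd_id, one_pow]
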